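/- Let $\Bbbk$ be a field and let $\chi$ be a family of invertible elements $\beta_n$ ($n\in\mathbb Z$), $c_n^+$ ($n\ge 0$), $c_n^-$ ($n\le 0$) of $\Bbbk$. **The 2-category $\mathcal U_\chi$.** Its objects are the integers. Its 1-morphisms are formal direct sums of $\mathcal E_\varepsilon 1_n\{t\}\colon n\to n+\sum_i 2\varepsilon_i$, where $\varepsilon=(\varepsilon_1,\dots,\varepsilon_m)$ is a sequence of signs, $t\in\mathbb Z$, $\mathcal E_\varepsilon=\mathcal E_{\varepsilon_1}\cdots\mathcal E_{\varepsilon_m}$, $\mathcal E_+=\mathcal E$ (upward strand) and $\mathcal E_-=\mathcal F$ (downward strand). The 2-morphisms $\mathcal E_\varepsilon 1_n\{t\}\to\mathcal E_{\varepsilon'}1_n\{t'\}$ are the $\Bbbk$-linear combinations of string diagrams of degree $t-t'$ with rightmost region $n$, modulo the local relations below (and the interchange law of a strict 2-category). Diagrams are built from identity strands, dots $x$ on $\mathcal E$ and on $\mathcal F$ (degree $2$), crossings $\tau$ on $\mathcal E\mathcal E$ and on $\mathcal F\mathcal F$ (degree $-2$), cups $1_n\to\mathcal F\mathcal E1_n$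 and caps $\mathcal F\mathcal E1_n\to 1_n$ (degree $1+n$), cups $1_n\to\mathcal E\mathcal F1_n$ and caps $\mathcal E\mathcal F1_n\to 1_n$ (degree $1-n$). For an integer label $a\geq 0$ write $\circlearrowright_a^n=\mathrm{cap}_{\mathcal E\mathcal F}\,x^a\,\mathrm{cup}_{\mathcal E\mathcal F}$ and $\circlearrowleft_a^n=\mathrm{cap}_{\mathcal F\mathcal E}\,x^a\,\mathrm{cup}_{\mathcal F\mathcal E}$ for the clockwise and counter-clockwise bubble with $a$ dots in a region labelled $n$. For $j\ge 0$ and negative labels one defines *fake bubbles*: $\circlearrowright^0_{-1}=c_0^+$, $\circlearrowleft^0_{-1}=c_0^-$, $$\circlearrowright^n_{n-1+j}=-\tfrac1{\beta_n}\sum_{\lambda\vdash j}\alpha_\lambda(n)\prod_i\circlearrowleft^n_{-n-1+\lambda_i}\quad(n<0,\ 0\le j\le -n),\qquad \circlearrowleft^n_{-n-1+j}=-\tfrac1{\beta_n}\sum_{\lambda\vdash j}\alpha_\lambda(n)\prod_i\circlearrowright^n_{n-1+\lambda_i}\quad(n>0,\ 0\le j\le n),$$ where, for a partition $\lambda$ with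 $m$ parts, $\alpha_\lambda(n)$ is $(c_n^{\pm})^{-(m+1)}$ (sign $+$ if $n>0$, $-$ if $n<0$) times the coefficient of $e_\lambda$ in the expansion of $(-1)^{|\lambda|}h_{|\lambda|}$ in elementary symmetric functions, i.e. times $(-1)^m$ times the number of distinct rearrangements of $\lambda$. The relations are, for all $n\in\mathbb Z$ (products are read from top to bottom, and sums over tuples of non-negative integers are empty if the prescribed total is negative): 1. the cups and caps satisfy the four zigzag identities making $\mathcal E$ and $\mathcal F$ biadjoint; 2. the dot (crossing) on downward strands equals both the left and the right rotation of the dot (crossing) on upward strands; 3. nilHecke relations: $\tau^2=0$, the braid relation on $\mathcal E\mathcal E\mathcal E$, and $\tau x_L-x_R\tau=1=x_L\tau-\tau x_R$ on $\mathcal E\mathcal E$, where $x_L,x_R$ are the dots on the left and right strand; 4. $\circlearrowright^n_a=0$ for $0\le a<n-1$, $\circlearrowleft^n_a=0$ for $0\le a<-n-1$, $\circlearrowright^n_{n-1}=c_n^+$ for $n\ge1$, $\circlearrowleft^n_{-n-1}=c_n^-$ for $n\le-1$; 5. closing the right strand of $\tau$ to the right, with rightmost region $n$, gives $-\sum_{f_1+f_2=-n}x^{f_1}\circlearrowright^n_{n-1+f_2}$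 (bubble on the right of the strand); closing the left strand of $\tau$ to the left, with leftmost region $n$, gives $\sum_{g_1+g_2=n}x^{g_1}\circlearrowleft^n_{-n-1+g_2}$ (bubble on the left of the strand); 6. with $\sigma\colon\mathcal E\mathcal F\to\mathcal F\mathcal E$ and $\sigma'\colon\mathcal F\mathcal E\to\mathcal E\mathcal F$ the sideways crossings obtained from $\tau$ by rotation, $$1_{\mathcal E\mathcal F1_n}=\beta_n\,\sigma'\sigma-\beta_n\sum_{f_1+f_2+f_3=n-1}x^{f_1}\mathrm{cup}_{\mathcal E\mathcal F}\,\circlearrowleft^n_{-n-1+f_2}\,\mathrm{cap}_{\mathcal E\mathcal F}x^{f_3},$$ $$1_{\mathcal F\mathcal E1_n}=\beta_n\,\sigma\sigma'-\beta_n\sum_{g_1+g_2+g_3=-n-1}x^{g_1}\mathrm{cup}_{\mathcal F\mathcal E}\,\circlearrowright^n_{n-1+g_2}\,\mathrm{cap}_{\mathcal F\mathcal E}x^{g_3}.$$ **Proposition.** Suppose that the diagrammatic calculus of $\mathcal U_\chi$ is consistent, in the sense that no object collapses: for every $n\in\mathbb Z$ the identity 2-morphism of $1_n$ is nonzero in $\mathcal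 U_\chi$. Then - $-c_0^+c_0^-\beta_0=1$; - $c_{-1}^-=1/c_1^+$; - $c_{n-2}^-=-\beta_n c_n^-$ for all $n\le 0$; - $c_{n+2}^+=-\beta_n c_n^+$ for all $n\ge 0$. -/

import Mathlib

/-!
The 2-category `U_χ`: objects are the integers, 1-morphisms are shifted signed sequences, and
2-morphisms are linear combinations of string diagrams modulo local relations.

Conventions. Diagrams are read from bottom to top and a composite is written `top * bottom`.
A diagram whose rightmost region is labelled `n` is a vertical stack of slices; in each slice one
elementary piece (dot, crossing, cup or cap) stands between vertical strands. The labels of all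
regions are determined by `n` and the strands.
-/

namespace UChi

/-- An upward strand `E` or a downward strand `F`. -/
inductive Strand
  | E
  | F

/-- Crossing `E` (resp. `F`) from right to left changes the region label by `2` (resp. `-2`). -/
def Strand.weight : Strand → ℤ
  | .E => 2
  | .F => -2

open Strand

/-- A signed sequence, written from left to right. With rightmost region `n` it is the 1-morphism
`𝓔_ε 1_n : n ⟶ n + weight`. -/
abbrev Word := List Strand

def Word.weight (w : Word) : ℤ := (w.map Strand.weight).sum

/-- The generating 2-morphisms. `cupFE : 1 ⟶ FE`, `cupEF : 1 ⟶ EF`, `capFE : FE ⟶ 1`,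
`capEF : EF ⟶ 1`. -/
inductive Gen
  | dotE
  | dotF
  | crossE
  | crossF
  | cupFE
  | cupEF
  | capFE
  | capEF

def Gen.src : Gen → Word
  | .dotE => [E]
  | .dotF => [F]
  | .crossE => [E, E]
  | .crossF => [F, F]
  | .cupFE => []
  | .cupEF => []
  | .capFE => [F, E]
  | .capEF => [E, F]

def Gen.tgt : Gen → Word
  | .dotE => [E]
  | .dotF => [F]
  | .crossE => [E, E]
  | .crossF => [F, F]
  | .cupFE => [F, E]
  | .cupEF => [E, F]
  | .capFE => []
  | .capEF => []

/-- The degree of a generator whose right-hand region is labelled `n`. -/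
def Gen.degree (n : ℤ) : Gen → ℤ
  | .dotE => 2
  | .dotF => 2
  | .crossE => -2
  | .crossF => -2
  | .cupFE => 1 + n
  | .cupEF => 1 - n
  | .capFE => 1 + n
  | .capEF => 1 - n

/-- A generator with vertical strands `left` on its left and `right` on its right. -/
structure Slice where
  left : Word
  gen : Gen
  right : Word

def Slice.src (s : Slice) : Word := s.left ++ s.gen.src ++ s.right

def Slice.tgt (s : Slice) : Word := s.left ++ s.gen.tgt ++ s.right

/-- The degree of a slice whose rightmost region is labelled `n`. -/
def Slice.degree (n : ℤ) (s : Slice) : ℤ := s.gen.degree (n + s.right.weight)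

/-- Noncommutative polynomials in slices; a stack of slices is a monomial, with the top slice as
first factor. The monomials that are diagrams are singled out by `IsDiagram`. -/
abbrev Pre (k : Type*) [Field k] := FreeAlgebra k Slice

section

variable (k : Type*) [Field k]

/-- The slice with generator `g` between the strands `u` and `v`. -/
def sl (u : Word) (g : Gen) (v : Word) : Pre k := FreeAlgebra.ι k ⟨u, g, v⟩

/-- Placing vertical strands `u` on the left and `v` on the right of everything. -/
noncomputable def whisker (u v : Word) : Pre k →ₐ[k] Pre k :=
  FreeAlgebra.lift k fun s : Slice => sl k (u ++ s.left) s.gen (s.right ++ v)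

/-- `IsDiagram k n w w' d p`: the monomial `p` is a string diagram from `w` to `w'` of degree `d`,
with rightmost region `n`. -/
inductive IsDiagram (n : ℤ) : Word → Word → ℤ → Pre k → Prop
  | refl (w : Word) : IsDiagram n w w 0 1
  | stack (s : Slice) {w : Word} {d : ℤ} {p : Pre k} (h : IsDiagram n w s.src d p) :
      IsDiagram n w s.tgt (s.degree n + d) (FreeAlgebra.ι k s * p)

/-- Linear combinations of diagrams of degree `d` from `w` to `w'`. -/
def diagrams (n : ℤ) (w w' : Word) (d : ℤ) : Submodule k (Pre k) :=
  Submodule.span k {p | IsDiagram k n w w' d p}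

/-- The clockwise circle carrying `a` dots. -/
def cwReal (a : ℕ) : Pre k := sl k [] .capEF [] * sl k [] .dotE [F] ^ a * sl k [] .cupEF []

/-- The counter-clockwise circle carrying `a` dots. -/
def ccwReal (a : ℕ) : Pre k := sl k [] .capFE [] * sl k [F] .dotE [] ^ a * sl k [] .cupFE []

/-- The sideways crossing `EF ⟶ FE`. -/
def crossEF : Pre k :=
  sl k [F, E] .capEF [] * sl k [F] .crossE [F] * sl k [] .cupFE [E, F]

/-- The sideways crossing `FE ⟶ EF`. -/
def crossFE : Pre k :=
  sl k [] .capFE [E, F] * sl k [F] .crossE [F] * sl k [F, E] .cupEF []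

variable {k}

/-- With `c` the value of the degree zero bubble, the coefficient `α_λ` of `e_λ = e_{λ₁} ⋯ e_{λ_m}`
determined by `∑_{|λ| ≤ b} α_λ e_λ e_{b-|λ|} = δ_{b,0}`, where `e_0 = c`: this is `c^{-(m+1)}`
times the coefficient of `e_λ` in the expansion of `(-1)^{|λ|} h_{|λ|}` in elementary symmetric
functions, and the latter is `(-1)^m` times the number of distinct rearrangements of `λ`. -/
noncomputable def alpha (c : k) {j : ℕ} (lam : Nat.Partition j) : k :=
  (c⁻¹) ^ (lam.parts.card + 1) * ((-1) ^ lam.parts.card * (lam.parts.countPerms : k))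

variable (k)

/-- The parameters `χ`. Only the values `cPlus n` for `n ≥ 0` and `cMinus n` for `n ≤ 0` are
part of `χ`; the other values of these two functions are never used. -/
structure Params where
  β : ℤ → kˣ
  cPlus : ℤ → kˣ
  cMinus : ℤ → kˣ

variable {k}

/-- The clockwise bubble of degree `2j`, labelled `n - 1 + j`, in a region `n`: a circle with
`n - 1 + j` dots when this number is nonnegative, and a fake bubble otherwise. -/
noncomputable def cw (χ : Params k) (n : ℤ) (j : ℕ) : Pre k :=
  if 0 ≤ n - 1 + j then cwReal k (n - 1 + j).toNat
  else if n = 0 then (χ.cPlus 0 : k) • 1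
  else (-(χ.β n : k)⁻¹) • ∑ lam : Nat.Partition j, alpha (χ.cMinus n : k) lam •
    ((lam.parts.sort (· ≥ ·)).map fun i : ℕ => ccwReal k (-n - 1 + i).toNat).prod

/-- The counter-clockwise bubble of degree `2j`, labelled `-n - 1 + j`, in a region `n`: a circle
with `-n - 1 + j` dots when this number is nonnegative, and a fake bubble otherwise. -/
noncomputable def ccw (χ : Params k) (n : ℤ) (j : ℕ) : Pre k :=
  if 0 ≤ -n - 1 + j then ccwReal k (-n - 1 + j).toNat
  else if n = 0 then (χ.cMinus 0 : k) • 1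
  else (-(χ.β n : k)⁻¹) • ∑ lam : Nat.Partition j, alpha (χ.cPlus n : k) lam •
    ((lam.parts.sort (· ≥ ·)).map fun i : ℕ => cwReal k (n - 1 + i).toNat).prod

/-- The tuples of `r` natural numbers with sum `s`; none if `s < 0`. -/
def tuples (r : ℕ) (s : ℤ) : Finset (Fin r → ℕ) :=
  if 0 ≤ s then Finset.Nat.antidiagonalTuple r s.toNat else ∅

/-- The defining local relations. `LocalRel χ n a b x y` says that `x = y` is imposed between
diagrams from `a` to `b` with rightmost region `n`. -/
inductive LocalRel (χ : Params k) : ℤ → Word → Word → Pre k → Pre k → Prop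
  -- far apart pieces may be moved past each other vertically (interchange law)
  | interchange (n : ℤ) (g h : Gen) (m : Word) :
      LocalRel χ n (g.src ++ m ++ h.src) (g.tgt ++ m ++ h.tgt)
        (sl k [] g (m ++ h.tgt) * sl k (g.src ++ m) h [])
        (sl k (g.tgt ++ m) h [] * sl k [] g (m ++ h.src))
  -- biadjointness
  | zigzag₁ (n : ℤ) : LocalRel χ n [E] [E] (sl k [E] .capFE [] * sl k [] .cupEF [E]) 1
  | zigzag₂ (n : ℤ) : LocalRel χ n [F] [F] (sl k [F] .capEF [] * sl k [] .cupFE [F]) 1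
  | zigzag₃ (n : ℤ) : LocalRel χ n [E] [E] (sl k [] .capEF [E] * sl k [E] .cupFE []) 1
  | zigzag₄ (n : ℤ) : LocalRel χ n [F] [F] (sl k [] .capFE [F] * sl k [F] .cupEF []) 1
  -- cyclicity of the dot
  | dotCyclic₁ (n : ℤ) : LocalRel χ n [F] [F]
      (sl k [] .capFE [F] * sl k [F] .dotE [F] * sl k [F] .cupEF []) (sl k [] .dotF [])
  | dotCyclic₂ (n : ℤ) : LocalRel χ n [F] [F]
      (sl k [F] .capEF [] * sl k [F] .dotE [F] * sl k [] .cupFE [F]) (sl k [] .dotF [])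
  -- cyclicity of the crossing
  | crossCyclic₁ (n : ℤ) : LocalRel χ n [F, F] [F, F]
      (sl k [] .capFE [F, F] * sl k [F] .capFE [E, F, F] * sl k [F, F] .crossE [F, F] *
        sl k [F, F, E] .cupEF [F] * sl k [F, F] .cupEF [])
      (sl k [] .crossF [])
  | crossCyclic₂ (n : ℤ) : LocalRel χ n [F, F] [F, F]
      (sl k [F, F] .capEF [] * sl k [F, F, E] .capEF [F] * sl k [F, F] .crossE [F, F] *
        sl k [F] .cupFE [E, F, F] * sl k [] .cupFE [F, F])
      (sl k [] .crossF [])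
  -- nilHecke relations
  | crossSq (n : ℤ) : LocalRel χ n [E, E] [E, E] (sl k [] .crossE [] * sl k [] .crossE []) 0
  | braid (n : ℤ) : LocalRel χ n [E, E, E] [E, E, E]
      (sl k [] .crossE [E] * sl k [E] .crossE [] * sl k [] .crossE [E])
      (sl k [E] .crossE [] * sl k [] .crossE [E] * sl k [E] .crossE [])
  | dotSlide₁ (n : ℤ) : LocalRel χ n [E, E] [E, E] 1
      (sl k [] .crossE [] * sl k [] .dotE [E] - sl k [E] .dotE [] * sl k [] .crossE [])
  | dotSlide₂ (n : ℤ) : LocalRel χ n [E, E] [E, E] 1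
      (sl k [] .dotE [E] * sl k [] .crossE [] - sl k [] .crossE [] * sl k [E] .dotE [])
  -- bubbles of negative degree vanish
  | cwNeg (n : ℤ) (a : ℕ) (h : (a : ℤ) < n - 1) : LocalRel χ n [] [] (cwReal k a) 0
  | ccwNeg (n : ℤ) (a : ℕ) (h : (a : ℤ) < -n - 1) : LocalRel χ n [] [] (ccwReal k a) 0
  -- bubbles of degree zero
  | cwZero (n : ℤ) (h : 1 ≤ n) :
      LocalRel χ n [] [] (cwReal k (n - 1).toNat) ((χ.cPlus n : k) • 1)
  | ccwZero (n : ℤ) (h : n ≤ -1) :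
      LocalRel χ n [] [] (ccwReal k (-n - 1).toNat) ((χ.cMinus n : k) • 1)
  -- the curl on the right of `E 1_n`
  | rightCurl (n : ℤ) : LocalRel χ n [E] [E]
      (sl k [E] .capEF [] * sl k [] .crossE [F] * sl k [E] .cupEF [])
      (-∑ f ∈ tuples 2 (-n), sl k [] .dotE [] ^ f 0 * whisker k [E] [] (cw χ n (f 1)))
  -- the curl on the left of `1_n E`, whose right-hand region is `n - 2`
  | leftCurl (n : ℤ) : LocalRel χ (n - 2) [E] [E]
      (sl k [] .capFE [E] * sl k [F] .crossE [] * sl k [] .cupFE [E])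
      (∑ g ∈ tuples 2 n, sl k [] .dotE [] ^ g 0 * whisker k [] [E] (ccw χ n (g 1)))
  -- decomposition of the identity of `EF 1_n`; dots on cups and caps are drawn on the `E` leg
  -- (by cyclicity of the dot the leg does not matter)
  | identEF (n : ℤ) : LocalRel χ n [E, F] [E, F] 1
      ((χ.β n : k) • (crossFE k * crossEF k) - (χ.β n : k) • ∑ f ∈ tuples 3 (n - 1),
        sl k [] .dotE [F] ^ f 0 * sl k [] .cupEF [] * ccw χ n (f 1) *
          (sl k [] .capEF [] * sl k [] .dotE [F] ^ f 2))
  -- decomposition of the identity of `FE 1_n`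
  | identFE (n : ℤ) : LocalRel χ n [F, E] [F, E] 1
      ((χ.β n : k) • (crossEF k * crossFE k) - (χ.β n : k) • ∑ g ∈ tuples 3 (-n - 1),
        sl k [F] .dotE [] ^ g 0 * sl k [] .cupFE [] * cw χ n (g 1) *
          (sl k [] .capFE [] * sl k [F] .dotE [] ^ g 2))

/-- All consequences of the local relations: a local relation may be applied inside any diagram,
with strands `u`, `v` on its two sides, a diagram `B` below and a diagram `A` above. -/
def relations (χ : Params k) (n : ℤ) (w w' : Word) : Submodule k (Pre k) :=
  Submodule.span k {r | ∃ (u v a b : Word) (x y A B : Pre k) (d d' : ℤ),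
    LocalRel χ (n + v.weight) a b x y ∧
    IsDiagram k n w (u ++ a ++ v) d B ∧ IsDiagram k n (u ++ b ++ v) w' d' A ∧
    r = A * whisker k u v (x - y) * B}

/-- The space of 2-morphisms `𝓔_w 1_n {t} ⟶ 𝓔_{w'} 1_n {t'}` of `U_χ`: linear combinations of
diagrams of degree `t - t'`, modulo the relations. -/
abbrev Hom₂ (χ : Params k) (n : ℤ) (w : Word) (t : ℤ) (w' : Word) (t' : ℤ) : Type _ :=
  diagrams k n w w' (t - t') ⧸
    (relations χ n w w').comap (diagrams k n w w' (t - t')).subtype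

theorem one_mem_diagrams (n : ℤ) (w : Word) (t : ℤ) : (1 : Pre k) ∈ diagrams k n w w (t - t) := by
  rw [sub_self]
  exact Submodule.subset_span (IsDiagram.refl w)

/-- The identity 2-morphism of `𝓔_w 1_n {t}`. -/
def id₂ (χ : Params k) (n : ℤ) (w : Word) (t : ℤ) : Hom₂ χ n w t w t :=
  Submodule.Quotient.mk ⟨1, one_mem_diagrams n w t⟩

/-- The calculus of `U_χ` is consistent: no object collapses, that is, for every `n` the identity
2-morphism of the identity 1-morphism `1_n` is nonzero. -/
def Consistent (χ : Params k) : Prop := ∀ n : ℤ, id₂ χ n [] 0 ≠ 0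

end

end UChi

/-! Each identity is an evaluation of one closed piece of diagram next to an upward strand in two
ways. The result has the form c • id_E = 0 for a scalar c. Closing the strand to a real bubble of
degree zero, whose value is a unit, turns this into c • id = 0 on an identity 1-morphism, and
consistency forces c = 0.

For the recursion on `cMinus`, put the counter-clockwise bubble of degree zero in region n - 2 to
the right of a strand E. Its value is c⁻_{n-2}. Between the strand and the bubble lies EF 1_n, and
for n ≤ 0 its identity is β_n σ'σ with no correction. Zigzags then turn the picture into a left
closure of two crossings with -n + 1 dots between them. Sliding the dots through a crossing by the
nilHecke relations, and using τ² = 0, leaves only a curl with -n dots on its loop, with sign -1.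
That curl equals c⁻_n, so c⁻_{n-2} = -β_n c⁻_n. The recursion on `cPlus` is the mirror image.

For n = 1 the same insertion has one correction term, a cup over a cap with coefficient 1/c₁⁺. The
undotted bubble makes the crossing term vanish because τ² = 0, and zigzags straighten the correction
to id_E. For n = 0, σ takes the cup of EF to -c₀⁺ times the cup of FE, and σ' takes that back with
factor c₀⁻. Comparing with 1 = β₀ σ'σ gives the remaining identity.

To compute with ring identities rather than in quotients of spaces of diagrams, everything takes
place in a `Rep`: an algebra with one idempotent per word. The 2-morphisms out of 1_n carry a `Rep`
that detects consistency. -/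

namespace UChi

open Strand

section

variable {k : Type*} [Field k]

/-! ### Diagrams of arbitrary degree: closure under stacking and whiskering. -/

/-- Linear combinations of diagrams from `w` to `w'` of arbitrary degrees. -/
def diagramSpan (k : Type*) [Field k] (n : ℤ) (w w' : Word) : Submodule k (Pre k) :=
  Submodule.span k {p | ∃ d, IsDiagram k n w w' d p}

theorem IsDiagram.mul {n : ℤ} {w w' w'' : Word} {d d' : ℤ} {p q : Pre k}
    (hp : IsDiagram k n w' w'' d p) (hq : IsDiagram k n w w' d' q) :
    ∃ d'', IsDiagram k n w w'' d'' (p * q) := by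
  induction hp with
  | refl => exact ⟨d', by simpa using hq⟩
  | stack s h ih =>
    obtain ⟨d'', h''⟩ := ih hq
    exact ⟨_, by simpa only [mul_assoc] using IsDiagram.stack s h''⟩

theorem whisker_sl (u v a b : Word) (g : Gen) :
    whisker k u v (sl k a g b) = sl k (u ++ a) g (b ++ v) := by
  simp [whisker, sl]

theorem whisker_whisker (u v u' v' : Word) (p : Pre k) :
    whisker k u v (whisker k u' v' p) = whisker k (u ++ u') (v' ++ v) p := by
  have : (whisker k u v).comp (whisker k u' v') = whisker k (u ++ u') (v' ++ v) := by
    ext s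
    simp [whisker, sl]
  exact DFunLike.congr_fun this p

theorem IsDiagram.whisker {n : ℤ} {w w' : Word} {d : ℤ} {p : Pre k}
    (hp : IsDiagram k n w w' d p) (n' : ℤ) (u v : Word) :
    ∃ d', IsDiagram k n' (u ++ w ++ v) (u ++ w' ++ v) d' (whisker k u v p) := by
  induction hp with
  | refl => exact ⟨0, by simpa using IsDiagram.refl _⟩
  | stack s h ih =>
    obtain ⟨d', h'⟩ := ih
    have hs : u ++ s.src ++ v = Slice.src ⟨u ++ s.left, s.gen, s.right ++ v⟩ := by
      simp [Slice.src]
    have ht : u ++ s.tgt ++ v = Slice.tgt ⟨u ++ s.left, s.gen, s.right ++ v⟩ := by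
      simp [Slice.tgt]
    rw [hs] at h'
    rw [ht, map_mul]
    have := IsDiagram.stack _ h'
    exact ⟨_, by simpa [UChi.whisker, sl] using this⟩

theorem one_mem_diagramSpan (n : ℤ) (w : Word) : (1 : Pre k) ∈ diagramSpan k n w w :=
  Submodule.subset_span ⟨0, .refl w⟩

theorem mul_mem_diagramSpan {n : ℤ} {w w' w'' : Word} {p q : Pre k}
    (hp : p ∈ diagramSpan k n w' w'') (hq : q ∈ diagramSpan k n w w') :
    p * q ∈ diagramSpan k n w w'' := by
  have h := Submodule.mul_mem_mul hp hq
  rw [diagramSpan, diagramSpan, Submodule.span_mul_span] at h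
  refine Submodule.span_mono ?_ h
  rintro _ ⟨a, ⟨d, ha⟩, b, ⟨d', hb⟩, rfl⟩
  exact ha.mul hb

theorem pow_mem_diagramSpan {n : ℤ} {w : Word} {p : Pre k}
    (hp : p ∈ diagramSpan k n w w) (a : ℕ) : p ^ a ∈ diagramSpan k n w w := by
  induction a with
  | zero => simpa using one_mem_diagramSpan n w
  | succ a ih => simpa only [pow_succ] using mul_mem_diagramSpan ih hp

theorem ι_mem_diagramSpan (n : ℤ) (s : Slice) :
    FreeAlgebra.ι k s ∈ diagramSpan k n s.src s.tgt :=
  Submodule.subset_span ⟨_, by simpa using IsDiagram.stack s (.refl _)⟩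

theorem sl_mem_diagramSpan (n : ℤ) (u : Word) (g : Gen) (v : Word) :
    sl k u g v ∈ diagramSpan k n (u ++ g.src ++ v) (u ++ g.tgt ++ v) :=
  ι_mem_diagramSpan n ⟨u, g, v⟩

theorem whisker_mem_diagramSpan {n : ℤ} {w w' : Word} {p : Pre k}
    (hp : p ∈ diagramSpan k n w w') (n' : ℤ) (u v : Word) :
    whisker k u v p ∈ diagramSpan k n' (u ++ w ++ v) (u ++ w' ++ v) := by
  have h := Submodule.mem_map_of_mem (f := (whisker k u v).toLinearMap) hp
  rw [diagramSpan, Submodule.map_span] at h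
  refine Submodule.span_mono ?_ h
  rintro _ ⟨a, ⟨d, ha⟩, rfl⟩
  exact ha.whisker n' u v

theorem cwReal_mem_diagramSpan (n : ℤ) (a : ℕ) : cwReal k a ∈ diagramSpan k n [] [] :=
  mul_mem_diagramSpan (mul_mem_diagramSpan (sl_mem_diagramSpan n [] .capEF [])
    (pow_mem_diagramSpan (sl_mem_diagramSpan n [] .dotE [F]) a))
    (sl_mem_diagramSpan n [] .cupEF [])

theorem ccwReal_mem_diagramSpan (n : ℤ) (a : ℕ) : ccwReal k a ∈ diagramSpan k n [] [] :=
  mul_mem_diagramSpan (mul_mem_diagramSpan (sl_mem_diagramSpan n [] .capFE [])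
    (pow_mem_diagramSpan (sl_mem_diagramSpan n [F] .dotE []) a))
    (sl_mem_diagramSpan n [] .cupFE [])

theorem list_prod_mem_diagramSpan {n : ℤ} {w : Word} (l : List (Pre k))
    (h : ∀ p ∈ l, p ∈ diagramSpan k n w w) : l.prod ∈ diagramSpan k n w w := by
  induction l with
  | nil => simpa using one_mem_diagramSpan n w
  | cons p l ih =>
    rw [List.prod_cons]
    exact mul_mem_diagramSpan (h p (by simp)) (ih fun q hq => h q (by simp [hq]))

theorem cw_mem_diagramSpan (χ : Params k) (m n : ℤ) (j : ℕ) :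
    cw χ m j ∈ diagramSpan k n [] [] := by
  unfold cw
  split_ifs
  · exact cwReal_mem_diagramSpan _ _
  · exact Submodule.smul_mem _ _ (one_mem_diagramSpan _ _)
  · refine Submodule.smul_mem _ _ (Submodule.sum_mem _ fun lam _ => Submodule.smul_mem _ _
      (list_prod_mem_diagramSpan _ fun p hp => ?_))
    obtain ⟨i, -, rfl⟩ := List.mem_map.1 hp
    exact ccwReal_mem_diagramSpan _ _

theorem ccw_mem_diagramSpan (χ : Params k) (m n : ℤ) (j : ℕ) :
    ccw χ m j ∈ diagramSpan k n [] [] := by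
  unfold ccw
  split_ifs
  · exact ccwReal_mem_diagramSpan _ _
  · exact Submodule.smul_mem _ _ (one_mem_diagramSpan _ _)
  · refine Submodule.smul_mem _ _ (Submodule.sum_mem _ fun lam _ => Submodule.smul_mem _ _
      (list_prod_mem_diagramSpan _ fun p hp => ?_))
    obtain ⟨i, -, rfl⟩ := List.mem_map.1 hp
    exact cwReal_mem_diagramSpan _ _

theorem sl_mem_diagramSpan' (n : ℤ) {u : Word} {g : Gen} {v w w' : Word}
    (h : w = u ++ g.src ++ v) (h' : w' = u ++ g.tgt ++ v) :
    sl k u g v ∈ diagramSpan k n w w' := by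
  subst h h'
  exact sl_mem_diagramSpan n u g v

theorem crossEF_mem_diagramSpan (n : ℤ) : crossEF k ∈ diagramSpan k n [E, F] [F, E] :=
  mul_mem_diagramSpan (mul_mem_diagramSpan (sl_mem_diagramSpan n [F, E] .capEF [])
    (sl_mem_diagramSpan n [F] .crossE [F])) (sl_mem_diagramSpan n [] .cupFE [E, F])

theorem crossFE_mem_diagramSpan (n : ℤ) : crossFE k ∈ diagramSpan k n [F, E] [E, F] :=
  mul_mem_diagramSpan (mul_mem_diagramSpan (sl_mem_diagramSpan n [] .capFE [E, F])
    (sl_mem_diagramSpan n [F] .crossE [F])) (sl_mem_diagramSpan n [F, E] .cupEF [])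

/-- Both sides of a local relation are linear combinations of diagrams. -/
theorem LocalRel.mem_diagramSpan {χ : Params k} {m : ℤ} {a b : Word} {x y : Pre k}
    (h : LocalRel χ m a b x y) (n : ℤ) :
    x ∈ diagramSpan k n a b ∧ y ∈ diagramSpan k n a b := by
  have S := @sl_mem_diagramSpan k _ n
  have M := @mul_mem_diagramSpan k _ n
  have P := @pow_mem_diagramSpan k _ n
  cases h with
  | interchange _ g h m =>
    refine ⟨M (w' := g.src ++ m ++ h.tgt) ?_ ?_, M (w' := g.tgt ++ m ++ h.src) ?_ ?_⟩ <;>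
      exact sl_mem_diagramSpan' n (by simp) (by simp)
  | zigzag₁ => exact ⟨M (S [E] .capFE []) (S [] .cupEF [E]), one_mem_diagramSpan _ _⟩
  | zigzag₂ => exact ⟨M (S [F] .capEF []) (S [] .cupFE [F]), one_mem_diagramSpan _ _⟩
  | zigzag₃ => exact ⟨M (S [] .capEF [E]) (S [E] .cupFE []), one_mem_diagramSpan _ _⟩
  | zigzag₄ => exact ⟨M (S [] .capFE [F]) (S [F] .cupEF []), one_mem_diagramSpan _ _⟩
  | dotCyclic₁ =>
    exact ⟨M (M (S [] .capFE [F]) (S [F] .dotE [F])) (S [F] .cupEF []), S [] .dotF []⟩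
  | dotCyclic₂ =>
    exact ⟨M (M (S [F] .capEF []) (S [F] .dotE [F])) (S [] .cupFE [F]), S [] .dotF []⟩
  | crossCyclic₁ =>
    exact ⟨M (M (M (M (S [] .capFE [F, F]) (S [F] .capFE [E, F, F])) (S [F, F] .crossE [F, F]))
      (S [F, F, E] .cupEF [F])) (S [F, F] .cupEF []), S [] .crossF []⟩
  | crossCyclic₂ =>
    exact ⟨M (M (M (M (S [F, F] .capEF []) (S [F, F, E] .capEF [F])) (S [F, F] .crossE [F, F]))
      (S [F] .cupFE [E, F, F])) (S [] .cupFE [F, F]), S [] .crossF []⟩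
  | crossSq => exact ⟨M (S [] .crossE []) (S [] .crossE []), Submodule.zero_mem _⟩
  | braid =>
    exact ⟨M (M (S [] .crossE [E]) (S [E] .crossE [])) (S [] .crossE [E]),
      M (M (S [E] .crossE []) (S [] .crossE [E])) (S [E] .crossE [])⟩
  | dotSlide₁ =>
    exact ⟨one_mem_diagramSpan _ _, Submodule.sub_mem _ (M (S [] .crossE []) (S [] .dotE [E]))
      (M (S [E] .dotE []) (S [] .crossE []))⟩
  | dotSlide₂ =>
    exact ⟨one_mem_diagramSpan _ _, Submodule.sub_mem _ (M (S [] .dotE [E]) (S [] .crossE []))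
      (M (S [] .crossE []) (S [E] .dotE []))⟩
  | cwNeg => exact ⟨cwReal_mem_diagramSpan _ _, Submodule.zero_mem _⟩
  | ccwNeg => exact ⟨ccwReal_mem_diagramSpan _ _, Submodule.zero_mem _⟩
  | cwZero =>
    exact ⟨cwReal_mem_diagramSpan _ _, Submodule.smul_mem _ _ (one_mem_diagramSpan _ _)⟩
  | ccwZero =>
    exact ⟨ccwReal_mem_diagramSpan _ _, Submodule.smul_mem _ _ (one_mem_diagramSpan _ _)⟩
  | rightCurl =>
    exact ⟨M (M (S [E] .capEF []) (S [] .crossE [F])) (S [E] .cupEF []),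
      Submodule.neg_mem _ (Submodule.sum_mem _ fun f _ => M (P (S [] .dotE []) _)
        (whisker_mem_diagramSpan (cw_mem_diagramSpan χ _ n _) n [E] []))⟩
  | leftCurl =>
    exact ⟨M (M (S [] .capFE [E]) (S [F] .crossE [])) (S [] .cupFE [E]),
      Submodule.sum_mem _ fun f _ => M (P (S [] .dotE []) _)
        (whisker_mem_diagramSpan (ccw_mem_diagramSpan χ _ n _) n [] [E])⟩
  | identEF =>
    exact ⟨one_mem_diagramSpan _ _, Submodule.sub_mem _
      (Submodule.smul_mem _ _ (M (crossFE_mem_diagramSpan n) (crossEF_mem_diagramSpan n)))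
      (Submodule.smul_mem _ _ (Submodule.sum_mem _ fun f _ =>
        M (M (M (P (S [] .dotE [F]) _) (S [] .cupEF [])) (ccw_mem_diagramSpan χ _ n _))
          (M (S [] .capEF []) (P (S [] .dotE [F]) _))))⟩
  | identFE =>
    exact ⟨one_mem_diagramSpan _ _, Submodule.sub_mem _
      (Submodule.smul_mem _ _ (M (crossEF_mem_diagramSpan n) (crossFE_mem_diagramSpan n)))
      (Submodule.smul_mem _ _ (Submodule.sum_mem _ fun f _ =>
        M (M (M (P (S [F] .dotE []) _) (S [] .cupFE [])) (cw_mem_diagramSpan χ _ n _))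
          (M (S [] .capFE []) (P (S [F] .dotE []) _))))⟩

/-! ### Stability of the relations, and representations of the calculus. -/

theorem mul_mem_relations {χ : Params k} {n : ℤ} {w w' w'' : Word} {p r : Pre k}
    (hp : p ∈ diagramSpan k n w' w'') (hr : r ∈ relations χ n w w') :
    p * r ∈ relations χ n w w'' := by
  have h := Submodule.mul_mem_mul hp hr
  rw [diagramSpan, relations, Submodule.span_mul_span] at h
  refine Submodule.span_mono ?_ h
  rintro _ ⟨a, ⟨d, ha⟩, _, ⟨u, v, a', b, x, y, A, B, e, e', hl, hB, hA, rfl⟩, rfl⟩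
  obtain ⟨d', h'⟩ := ha.mul hA
  exact ⟨u, v, a', b, x, y, _, B, e, d', hl, hB, h', by simp only [mul_assoc]⟩

/-- The generators of `relations` allow only a single diagram below the relation; linearity extends
this to combinations. -/
theorem whisker_sub_mul_mem_relations {χ : Params k} {n : ℤ} {u v a b : Word} {x y : Pre k}
    (h : LocalRel χ (n + v.weight) a b x y) {w : Word} {p : Pre k}
    (hp : p ∈ diagramSpan k n w (u ++ a ++ v)) :
    whisker k u v (x - y) * p ∈ relations χ n w (u ++ b ++ v) := by
  have h' := Submodule.mem_map_of_mem (f := LinearMap.mulLeft k (whisker k u v (x - y))) hp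
  rw [diagramSpan, Submodule.map_span] at h'
  refine Submodule.span_mono ?_ h'
  rintro _ ⟨B, ⟨d, hB⟩, rfl⟩
  exact ⟨u, v, a, b, x, y, 1, B, d, 0, h, hB, .refl _, by simp⟩

/-- A representation of the calculus with rightmost region `m` in an algebra `R`: diagrams are sent
to elements of `R`, the identity of a 1-morphism `w` to an idempotent `e w`, and the local
relations hold. -/
structure Rep (χ : Params k) (m : ℤ) (R : Type*) [Ring R] [Algebra k R] where
  φ : Pre k →ₐ[k] R
  e : Word → R
  e_mul (s : Slice) : e s.tgt * φ (FreeAlgebra.ι k s) = φ (FreeAlgebra.ι k s)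
  mul_e (s : Slice) : φ (FreeAlgebra.ι k s) * e s.src = φ (FreeAlgebra.ι k s)
  rel {u v a b : Word} {x y : Pre k} (h : LocalRel χ (m + v.weight) a b x y) :
    φ (whisker k u v x) * e (u ++ a ++ v) = φ (whisker k u v y) * e (u ++ a ++ v)

theorem Word.weight_append (u v : Word) : (u ++ v : Word).weight = u.weight + v.weight := by
  simp [Word.weight]

/-- Placing strands `u` on the left and `v` on the right turns a representation with rightmost
region `n` into one with rightmost region `n + v.weight`. -/
noncomputable def Rep.whisker {χ : Params k} {n m : ℤ} {R : Type*} [Ring R] [Algebra k R]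
    (ρ : Rep χ n R) (u v : Word) (h : n + v.weight = m) : Rep χ m R where
  φ := ρ.φ.comp (UChi.whisker k u v)
  e w := ρ.e (u ++ w ++ v)
  e_mul s := by
    have := ρ.e_mul ⟨u ++ s.left, s.gen, s.right ++ v⟩
    simpa [UChi.whisker, sl, Slice.tgt] using this
  mul_e s := by
    have := ρ.mul_e ⟨u ++ s.left, s.gen, s.right ++ v⟩
    simpa [UChi.whisker, sl, Slice.src] using this
  rel {u' v' a b x y} hl := by
    -- Region labels agree: the strands `v` now stand to the right of everything, so their weight
    -- shifts the rightmost label.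
    have hm : m + v'.weight = n + (v' ++ v : Word).weight := by
      rw [Word.weight_append, ← h]; ring
    rw [hm] at hl
    have := ρ.rel (u := u ++ u') hl
    simpa [whisker_whisker] using this

/-! ### The representation on 2-morphisms out of the unit. -/

variable (χ : Params k) (n : ℤ)

/-- The 2-morphisms of all degrees from `1_n` to `w`. -/
def HomFromUnit (w : Word) : Type _ :=
  diagramSpan k n [] w ⧸ (relations χ n [] w).comap (diagramSpan k n [] w).subtype

noncomputable instance (w : Word) : AddCommGroup (HomFromUnit χ n w) :=
  inferInstanceAs (AddCommGroup (_ ⧸ (relations χ n [] w).comap (diagramSpan k n [] w).subtype))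

noncomputable instance (w : Word) : Module k (HomFromUnit χ n w) :=
  inferInstanceAs (Module k (_ ⧸ (relations χ n [] w).comap (diagramSpan k n [] w).subtype))

/-- The class of a linear combination of diagrams. -/
noncomputable def HomFromUnit.mk (w : Word) : diagramSpan k n [] w →ₗ[k] HomFromUnit χ n w :=
  ((relations χ n [] w).comap (diagramSpan k n [] w).subtype).mkQ

/-- Composition with a slice. -/
noncomputable def sliceAct (s : Slice) : HomFromUnit χ n s.src →ₗ[k] HomFromUnit χ n s.tgt :=
  Submodule.mapQ _ _
    ((LinearMap.mulLeft k (FreeAlgebra.ι k s)).restrict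
      (p := diagramSpan k n [] s.src) (q := diagramSpan k n [] s.tgt)
      fun _ hp => mul_mem_diagramSpan (ι_mem_diagramSpan n s) hp)
    fun _ hp => mul_mem_relations (ι_mem_diagramSpan n s) hp

open Classical in
/-- The action of diagrams on the sum of all 2-morphism spaces out of `1_n`. -/
noncomputable def unitAct : Pre k →ₐ[k] Module.End k (∀ w, HomFromUnit χ n w) :=
  FreeAlgebra.lift k fun s : Slice =>
    LinearMap.single k (HomFromUnit χ n) s.tgt ∘ₗ sliceAct χ n s ∘ₗ LinearMap.proj s.src

open Classical in
/-- The projection to the 2-morphisms from `1_n` to `w`. -/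
noncomputable def unitIdem (w : Word) : Module.End k (∀ w, HomFromUnit χ n w) :=
  LinearMap.single k (HomFromUnit χ n) w ∘ₗ LinearMap.proj w

variable {n} in
open Classical in
/-- The class of a linear combination of diagrams, in the sum of all 2-morphism spaces. -/
noncomputable def unitVec {w : Word} {p : Pre k} (hp : p ∈ diagramSpan k n [] w) :
    ∀ w, HomFromUnit χ n w :=
  Pi.single w (HomFromUnit.mk χ n w ⟨p, hp⟩)

variable {χ n}

theorem unitVec_eq {w : Word} {p q : Pre k} (hp : p ∈ diagramSpan k n [] w)
    (hq : q ∈ diagramSpan k n [] w) (h : p - q ∈ relations χ n [] w) :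
    unitVec χ hp = unitVec χ hq := by
  unfold unitVec
  congr 1
  exact (Submodule.Quotient.eq _).2 h

theorem unitAct_ι_unitVec {s : Slice} {p : Pre k} (hp : p ∈ diagramSpan k n [] s.src) :
    unitAct χ n (FreeAlgebra.ι k s) (unitVec χ hp) =
      unitVec χ (mul_mem_diagramSpan (ι_mem_diagramSpan n s) hp) := by
  simp only [unitAct, unitVec, FreeAlgebra.lift_ι_apply, LinearMap.comp_apply,
    LinearMap.proj_apply, Pi.single_eq_same, LinearMap.single_apply]
  rfl

theorem unitVec_congr {w : Word} {p q : Pre k} (hp : p ∈ diagramSpan k n [] w)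
    (hq : q ∈ diagramSpan k n [] w) (h : p = q) : unitVec χ hp = unitVec χ hq := by
  subst h; rfl

theorem unitVec_add {w : Word} {p q : Pre k} (hp : p ∈ diagramSpan k n [] w)
    (hq : q ∈ diagramSpan k n [] w) :
    unitVec χ (Submodule.add_mem _ hp hq) = unitVec χ hp + unitVec χ hq := by
  classical
  rw [unitVec, unitVec, unitVec, ← Pi.single_add, ← map_add]
  rfl

theorem unitVec_smul {w : Word} {p : Pre k} (c : k) (hp : p ∈ diagramSpan k n [] w) :
    unitVec χ (Submodule.smul_mem _ c hp) = c • unitVec χ hp := by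
  classical
  rw [unitVec, unitVec, ← Pi.single_smul, ← map_smul]
  rfl

theorem unitVec_eq_zero {w : Word} {p : Pre k} (hp : p ∈ diagramSpan k n [] w) (h : p = 0) :
    unitVec χ hp = 0 := by
  rw [← zero_smul k (unitVec χ hp), ← unitVec_smul]
  exact unitVec_congr _ _ (by rw [h, smul_zero])

theorem IsDiagram.unitAct_unitVec {w w' : Word} {d : ℤ} {p q : Pre k}
    (hp : IsDiagram k n w w' d p) (hq : q ∈ diagramSpan k n [] w) :
    unitAct χ n p (unitVec χ hq) =
      unitVec χ (mul_mem_diagramSpan (Submodule.subset_span ⟨d, hp⟩) hq) := by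
  induction hp with
  | refl =>
    rw [map_one, Module.End.one_apply]
    exact unitVec_congr _ _ (one_mul q).symm
  | stack s h ih =>
    rw [map_mul, Module.End.mul_apply, ih hq, unitAct_ι_unitVec]
    exact unitVec_congr _ _ (mul_assoc _ _ _).symm

theorem unitAct_unitVec {w w' : Word} {p q : Pre k} (hp : p ∈ diagramSpan k n w w')
    (hq : q ∈ diagramSpan k n [] w) :
    unitAct χ n p (unitVec χ hq) = unitVec χ (mul_mem_diagramSpan hp hq) := by
  induction hp using Submodule.span_induction with
  | mem p h =>
    obtain ⟨d, h⟩ := h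
    exact h.unitAct_unitVec hq
  | zero =>
    rw [map_zero, LinearMap.zero_apply]
    exact (unitVec_eq_zero _ (zero_mul q)).symm
  | add x y hx hy ihx ihy =>
    rw [map_add, LinearMap.add_apply, ihx, ihy, ← unitVec_add]
    exact unitVec_congr _ _ (add_mul _ _ _).symm
  | smul c x hx ih =>
    rw [map_smul, LinearMap.smul_apply, ih, ← unitVec_smul]
    exact unitVec_congr _ _ (smul_mul_assoc _ _ _).symm

/-- After projection to the component `w`, every vector is the class of some combination of
diagrams, so operators need only be compared there. -/
theorem mul_unitIdem_ext {w : Word} {f g : Module.End k (∀ w, HomFromUnit χ n w)}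
    (h : ∀ (p : Pre k) (hp : p ∈ diagramSpan k n [] w),
      f (unitVec χ hp) = g (unitVec χ hp)) :
    f * unitIdem χ n w = g * unitIdem χ n w := by
  refine LinearMap.ext fun v => ?_
  obtain ⟨⟨p, hp⟩, hv⟩ := Submodule.Quotient.mk_surjective _ (v w)
  have : unitIdem χ n w v = unitVec χ hp := by
    simp only [unitIdem, LinearMap.comp_apply, LinearMap.proj_apply, ← hv]
    rfl
  rw [Module.End.mul_apply, Module.End.mul_apply, this, h]

variable (χ n)

/-- The representation on all 2-morphisms out of `1_n`. -/
noncomputable def unitRep : Rep χ n (Module.End k (∀ w, HomFromUnit χ n w)) where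
  φ := unitAct χ n
  e := unitIdem χ n
  e_mul s := by
    refine LinearMap.ext fun v => ?_
    simp [unitAct, unitIdem]
  mul_e s := by
    refine LinearMap.ext fun v => ?_
    simp [unitAct, unitIdem]
  rel {u v a b x y} h := by
    refine mul_unitIdem_ext fun p hp => ?_
    have hm := h.mem_diagramSpan n
    rw [unitAct_unitVec (whisker_mem_diagramSpan hm.1 n u v),
      unitAct_unitVec (whisker_mem_diagramSpan hm.2 n u v)]
    refine unitVec_eq _ _ ?_
    rw [← sub_mul, ← map_sub]
    exact whisker_sub_mul_mem_relations h hp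

variable {χ}

/-- If the calculus is consistent, then nonzero multiples of the identity of `1_n` are nonzero. -/
theorem Consistent.eq_zero_of_smul_e_nil (hχ : Consistent χ) {c : k}
    (h : c • (unitRep χ n).e [] = 0) : c = 0 := by
  by_contra hc
  have h0 : (unitRep χ n).e [] = 0 := (smul_eq_zero.1 h).resolve_left hc
  refine hχ n ((Submodule.Quotient.mk_eq_zero _).2 ?_)
  -- Evaluate the vanishing idempotent at the class of the empty diagram. The submodule `relations`
  -- ignores degrees, so the conclusion applies to the degree-zero space used in `Consistent`.
  have h1 := congrFun (LinearMap.congr_fun h0 (unitVec χ (one_mem_diagramSpan n []))) []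
  simp only [unitRep, unitIdem, unitVec, LinearMap.comp_apply, LinearMap.proj_apply,
    LinearMap.single_apply, Pi.single_eq_same, LinearMap.zero_apply, Pi.zero_apply] at h1
  exact (Submodule.Quotient.mk_eq_zero
    ((relations χ n [] []).comap (diagramSpan k n [] []).subtype)).1 h1

/-! ### The local relations inside a representation. -/

namespace Rep

variable {χ : Params k} {m : ℤ} {R : Type*} [Ring R] [Algebra k R] (ρ : Rep χ m R)

/-- The image of a slice. -/
noncomputable def s (a : Word) (g : Gen) (b : Word) : R := ρ.φ (sl k a g b)

theorem φ_sl (a : Word) (g : Gen) (b : Word) : ρ.φ (sl k a g b) = ρ.s a g b := rfl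

theorem e_mul_s {w a : Word} {g : Gen} {b : Word} (h : w = a ++ (g.tgt ++ b)) :
    ρ.e w * ρ.s a g b = ρ.s a g b := by
  rw [h, ← List.append_assoc]
  exact ρ.e_mul ⟨a, g, b⟩

theorem s_mul_e {w a : Word} {g : Gen} {b : Word} (h : w = a ++ (g.src ++ b)) :
    ρ.s a g b * ρ.e w = ρ.s a g b := by
  rw [h, ← List.append_assoc]
  exact ρ.mul_e ⟨a, g, b⟩

theorem crossE_mul_e (a b : Word) :
    ρ.s a .crossE b * ρ.e (a ++ E :: E :: b) = ρ.s a .crossE b := ρ.s_mul_e rfl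

theorem dotE_mul_e (a b : Word) :
    ρ.s a .dotE b * ρ.e (a ++ E :: b) = ρ.s a .dotE b := ρ.s_mul_e rfl

theorem cupEF_mul_e (a b : Word) : ρ.s a .cupEF b * ρ.e (a ++ b) = ρ.s a .cupEF b :=
  ρ.s_mul_e rfl

theorem cupFE_mul_e (a b : Word) : ρ.s a .cupFE b * ρ.e (a ++ b) = ρ.s a .cupFE b :=
  ρ.s_mul_e rfl

theorem capEF_mul_e (a b : Word) :
    ρ.s a .capEF b * ρ.e (a ++ E :: F :: b) = ρ.s a .capEF b := ρ.s_mul_e rfl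

theorem interchange (a : Word) (g : Gen) (w : Word) (h : Gen) (b : Word) :
    ρ.s a g (w ++ (h.tgt ++ b)) * ρ.s (a ++ (g.src ++ w)) h b =
      ρ.s (a ++ (g.tgt ++ w)) h b * ρ.s a g (w ++ (h.src ++ b)) := by
  have := ρ.rel (u := a) (v := b) (.interchange _ g h w)
  simp only [map_mul, whisker_sl, φ_sl, List.append_nil, List.append_assoc, mul_assoc,
    List.nil_append] at this
  rwa [ρ.s_mul_e (by simp), ρ.s_mul_e (by simp)] at this

theorem zigzag₁ (a b : Word) :
    ρ.s (a ++ [E]) .capFE b * ρ.s a .cupEF (E :: b) = ρ.e (a ++ E :: b) := by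
  have := ρ.rel (u := a) (v := b) (.zigzag₁ _)
  simpa [whisker_sl, φ_sl, mul_assoc, ρ.s_mul_e, Gen.src,
    crossE_mul_e, dotE_mul_e, cupEF_mul_e, cupFE_mul_e, capEF_mul_e] using this

theorem zigzag₃ (a b : Word) :
    ρ.s a .capEF (E :: b) * ρ.s (a ++ [E]) .cupFE b = ρ.e (a ++ E :: b) := by
  have := ρ.rel (u := a) (v := b) (.zigzag₃ _)
  simpa [whisker_sl, φ_sl, mul_assoc, ρ.s_mul_e, Gen.src,
    crossE_mul_e, dotE_mul_e, cupEF_mul_e, cupFE_mul_e, capEF_mul_e] using this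

theorem crossSq (a b : Word) : ρ.s a .crossE b * ρ.s a .crossE b = 0 := by
  have := ρ.rel (u := a) (v := b) (.crossSq _)
  simpa [whisker_sl, φ_sl, mul_assoc, ρ.s_mul_e, Gen.src,
    crossE_mul_e, dotE_mul_e, cupEF_mul_e, cupFE_mul_e, capEF_mul_e] using this

theorem dotSlide₁ (a b : Word) : ρ.s a .crossE b * ρ.s a .dotE (E :: b) =
    ρ.s (a ++ [E]) .dotE b * ρ.s a .crossE b + ρ.e (a ++ E :: E :: b) := by
  have := ρ.rel (u := a) (v := b) (.dotSlide₁ _)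
  simp [whisker_sl, φ_sl, mul_assoc, dotE_mul_e, crossE_mul_e, sub_mul] at this
  rw [this]; abel

theorem dotSlide₂ (a b : Word) : ρ.s a .dotE (E :: b) * ρ.s a .crossE b =
    ρ.s a .crossE b * ρ.s (a ++ [E]) .dotE b + ρ.e (a ++ E :: E :: b) := by
  have := ρ.rel (u := a) (v := b) (.dotSlide₂ _)
  simp [whisker_sl, φ_sl, mul_assoc, ρ.s_mul_e, Gen.src, crossE_mul_e, sub_mul] at this
  rw [this]; abel

theorem cwNeg (a b : Word) (p : ℕ) (h : (p : ℤ) < m + b.weight - 1) :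
    ρ.s a .capEF b * ρ.s a .dotE (F :: b) ^ p * ρ.s a .cupEF b = 0 := by
  have := ρ.rel (u := a) (v := b) (.cwNeg _ p h)
  simpa [cwReal, whisker_sl, φ_sl, mul_assoc, ρ.s_mul_e, Gen.src,
    crossE_mul_e, dotE_mul_e, cupEF_mul_e, cupFE_mul_e, capEF_mul_e] using this

theorem ccwNeg (a b : Word) (p : ℕ) (h : (p : ℤ) < -(m + b.weight) - 1) :
    ρ.s a .capFE b * ρ.s (a ++ [F]) .dotE b ^ p * ρ.s a .cupFE b = 0 := by
  have := ρ.rel (u := a) (v := b) (.ccwNeg _ p h)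
  simpa [ccwReal, whisker_sl, φ_sl, mul_assoc, ρ.s_mul_e, Gen.src,
    crossE_mul_e, dotE_mul_e, cupEF_mul_e, cupFE_mul_e, capEF_mul_e] using this

theorem cwZero (a b : Word) (n : ℤ) (p : ℕ) (hn : m + b.weight = n) (h : n - 1 = p) :
    ρ.s a .capEF b * ρ.s a .dotE (F :: b) ^ p * ρ.s a .cupEF b =
      (χ.cPlus n : k) • ρ.e (a ++ b) := by
  subst hn
  have := ρ.rel (u := a) (v := b) (.cwZero _ (by omega))
  rw [h, Int.toNat_natCast] at this
  simpa [cwReal, whisker_sl, φ_sl, mul_assoc, ρ.s_mul_e, Gen.src,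
    crossE_mul_e, dotE_mul_e, cupEF_mul_e, cupFE_mul_e, capEF_mul_e] using this

theorem ccwZero (a b : Word) (n : ℤ) (p : ℕ) (hn : m + b.weight = n) (h : -n - 1 = p) :
    ρ.s a .capFE b * ρ.s (a ++ [F]) .dotE b ^ p * ρ.s a .cupFE b =
      (χ.cMinus n : k) • ρ.e (a ++ b) := by
  subst hn
  have := ρ.rel (u := a) (v := b) (.ccwZero _ (by omega))
  rw [h, Int.toNat_natCast] at this
  simpa [ccwReal, whisker_sl, φ_sl, mul_assoc, ρ.s_mul_e, Gen.src,
    crossE_mul_e, dotE_mul_e, cupEF_mul_e, cupFE_mul_e, capEF_mul_e] using this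

theorem _root_.UChi.tuples_of_neg (r : ℕ) {n : ℤ} (h : n < 0) : tuples r n = ∅ := by
  simp [tuples, h]

theorem _root_.UChi.tuples_zero (r : ℕ) : tuples r 0 = {0} := by
  simp [tuples, Finset.Nat.antidiagonalTuple_zero_right]

/-- For n > 0 the sum in the curl relation is empty; for n = 0 its only term is the fake bubble c₀⁺
without dots. -/
theorem rightCurl (a b : Word) (n : ℤ) (hn : m + b.weight = n) (h : 0 ≤ n) :
    ρ.s (a ++ [E]) .capEF b * ρ.s a .crossE (F :: b) * ρ.s (a ++ [E]) .cupEF b =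
      if n = 0 then -((χ.cPlus 0 : k) • ρ.e (a ++ E :: b)) else 0 := by
  subst hn
  have := ρ.rel (u := a) (v := b) (.rightCurl _)
  split_ifs with h0
  · rw [h0] at this
    simpa [tuples_zero, cw, whisker_sl, φ_sl, mul_assoc, ρ.s_mul_e, Gen.src,
    crossE_mul_e, dotE_mul_e, cupEF_mul_e, cupFE_mul_e, capEF_mul_e] using this
  · rw [tuples_of_neg _ (by omega)] at this
    simpa [whisker_sl, φ_sl, mul_assoc, ρ.s_mul_e, Gen.src,
    crossE_mul_e, dotE_mul_e, cupEF_mul_e, cupFE_mul_e, capEF_mul_e] using this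

theorem leftCurl (a b : Word) (n : ℤ) (hn : m + b.weight = n - 2) (h : n ≤ 0) :
    ρ.s a .capFE (E :: b) * ρ.s (a ++ [F]) .crossE b * ρ.s a .cupFE (E :: b) =
      if n = 0 then (χ.cMinus 0 : k) • ρ.e (a ++ E :: b) else 0 := by
  have h' := LocalRel.leftCurl (χ := χ) n
  rw [← hn] at h'
  have := ρ.rel (u := a) (v := b) h'
  split_ifs with h0
  · rw [h0] at this
    simpa [tuples_zero, ccw, whisker_sl, φ_sl, mul_assoc, ρ.s_mul_e, Gen.src,
    crossE_mul_e, dotE_mul_e, cupEF_mul_e, cupFE_mul_e, capEF_mul_e] using this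
  · rw [tuples_of_neg _ (by omega)] at this
    simpa [whisker_sl, φ_sl, mul_assoc, ρ.s_mul_e, Gen.src,
    crossE_mul_e, dotE_mul_e, cupEF_mul_e, cupFE_mul_e, capEF_mul_e] using this

/-- The correction sum runs over triples with total n - 1 < 0, hence is empty. -/
theorem identEF (a b : Word) (n : ℤ) (hn : m + b.weight = n) (h : n ≤ 0) :
    ρ.e (a ++ E :: F :: b) = (χ.β n : k) •
      (ρ.φ (UChi.whisker k a b (crossFE k)) * ρ.φ (UChi.whisker k a b (crossEF k))) := by
  subst hn
  have := ρ.rel (u := a) (v := b) (.identEF _)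
  rw [tuples_of_neg _ (by omega)] at this
  simpa [crossEF, crossFE, whisker_sl, φ_sl, mul_assoc, ρ.s_mul_e, Gen.src,
    crossE_mul_e, dotE_mul_e, cupEF_mul_e, cupFE_mul_e, capEF_mul_e] using this

theorem identFE (a b : Word) (n : ℤ) (hn : m + b.weight = n) (h : 0 ≤ n) :
    ρ.e (a ++ F :: E :: b) = (χ.β n : k) •
      (ρ.φ (UChi.whisker k a b (crossEF k)) * ρ.φ (UChi.whisker k a b (crossFE k))) := by
  subst hn
  have := ρ.rel (u := a) (v := b) (.identFE _)
  rw [tuples_of_neg _ (by omega)] at this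
  simpa [crossEF, crossFE, whisker_sl, φ_sl, mul_assoc, ρ.s_mul_e, Gen.src,
    crossE_mul_e, dotE_mul_e, cupEF_mul_e, cupFE_mul_e, capEF_mul_e] using this

/-- The single correction term contains the fake bubble of degree zero, -1/(β₁c₁⁺), coming from the
empty partition; its factor -1/β₁ cancels the prefactor -β₁. -/
theorem identEF_one (a b : Word) (hn : m + b.weight = 1) :
    ρ.e (a ++ E :: F :: b) = (χ.β 1 : k) •
      (ρ.φ (UChi.whisker k a b (crossFE k)) * ρ.φ (UChi.whisker k a b (crossEF k))) +
      (χ.cPlus 1 : k)⁻¹ • (ρ.s a .cupEF b * ρ.s a .capEF b) := by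
  have := ρ.rel (u := a) (v := b) (.identEF _)
  rw [hn, sub_self, tuples_zero] at this
  simpa [crossEF, crossFE, whisker_sl, φ_sl, mul_assoc, ρ.s_mul_e, Gen.src,
    crossE_mul_e, dotE_mul_e, cupEF_mul_e, cupFE_mul_e, capEF_mul_e, sub_mul, add_mul, ccw,
    alpha, Multiset.countPerms, Finsupp.multinomial] using this

end Rep

/-! ### The nilHecke computation between a cap and a cup. -/

section Curl

variable {R : Type*} [Ring R] [Algebra k R] {K U t L D x e E : R} {c : k} {N : ℕ}

/-- In a nilHecke algebra acting between a cap `K` and a cup `U`, with `L` the dots on the closed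
strand: a curl with `i ≤ N` dots on its loop vanishes for `i < N` and has value `c` for `i = N`. -/
theorem curl_pow (hLt : L * t = t * D + e) (hU : D * U = U * x) (heU : e * U = U)
    (hg : ∀ p < N, K * L ^ p * U = if p + 1 = N then c • E else 0)
    (h0 : K * t * U = if N = 0 then c • E else 0) (i : ℕ) (hi : i ≤ N) :
    K * L ^ i * t * U = if i = N then c • E else 0 := by
  induction i with
  | zero => simpa [eq_comm] using h0
  | succ i ih =>
    -- Sliding one dot off the loop gives a curl with fewer dots and, from the error term of the
    -- slide, a bubble with `i` dots. The former vanishes by induction; the latter is nonzero only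
    -- when `i + 1 = N`.
    have h1 : K * L ^ (i + 1) * t * U = K * L ^ i * t * U * x + K * L ^ i * U := by
      calc K * L ^ (i + 1) * t * U = K * L ^ i * (L * t) * U := by
            rw [pow_succ]; noncomm_ring
        _ = K * L ^ i * t * (D * U) + K * L ^ i * (e * U) := by rw [hLt]; noncomm_ring
        _ = _ := by rw [hU, heU]; noncomm_ring
    rw [h1, ih (by omega), hg i (by omega), if_neg (by omega), zero_mul, zero_add]

/-- Dots between the two crossings are moved one by one through the upper crossing onto the closed
strand. Each slide leaves an error term, a curl with as many loop dots as have already been moved.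
Such curls vanish below `N` dots, so only the last slide contributes, with sign -1; the main term
then dies by `t * t = 0`. -/
theorem cross_pow_cross (hLt : L * t = t * D + e) (htt : t * t = 0) (hLD : Commute L D)
    (hK : K * D = x * K) (hU : D * U = U * x) (heU : e * U = U) (het : e * t = t)
    (heD : e * D = D)
    (hg : ∀ p < N, K * L ^ p * U = if p + 1 = N then c • E else 0)
    (h0 : K * t * U = if N = 0 then c • E else 0) :
    K * t * D ^ (N + 1) * t * U = -(c • E) := by
  -- Here `e` is the idempotent of the word on which `t` and `D` act, so it is absorbed even when no
  -- dot is present.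
  have hz (j : ℕ) : e * (D ^ j * t) = D ^ j * t := by
    cases j with
    | zero => rw [pow_zero, one_mul, het]
    | succ j => rw [pow_succ', mul_assoc, ← mul_assoc e, heD]
  have hxK (j : ℕ) : K * D ^ j = x ^ j * K := (SemiconjBy.pow_right hK j : _)
  have hc := curl_pow hLt hU heU hg h0
  have step (i j : ℕ) : K * L ^ i * t * D ^ (j + 1) * t * U =
      K * L ^ (i + 1) * t * D ^ j * t * U - x ^ j * (K * L ^ i * t * U) := by
    have h1 : t * D = L * t - e := by rw [hLt]; abel
    calc K * L ^ i * t * D ^ (j + 1) * t * U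
        = K * L ^ i * (t * D) * (D ^ j * t) * U := by rw [pow_succ']; noncomm_ring
      _ = K * (L ^ i * L) * t * D ^ j * t * U - K * L ^ i * (e * (D ^ j * t)) * U := by
          rw [h1]; noncomm_ring
      _ = K * (L ^ i * L) * t * D ^ j * t * U - K * (L ^ i * D ^ j) * t * U := by
          rw [hz]; noncomm_ring
      _ = K * (L ^ i * L) * t * D ^ j * t * U - (K * D ^ j) * L ^ i * t * U := by
          rw [(hLD.pow_pow i j).eq]; noncomm_ring
      _ = _ := by rw [hxK, ← pow_succ]; noncomm_ring
  -- The invariant `i + j = N` counts the dots on the loop and all but one of those still between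
  -- the crossings.
  have main (j : ℕ) : ∀ i, i + j = N → K * L ^ i * t * D ^ (j + 1) * t * U = -(c • E) := by
    induction j with
    | zero =>
      intro i hi
      rw [step, hc i (by omega), if_pos (by omega), pow_zero, mul_one, mul_assoc _ t t, htt]
      simp
    | succ j ih =>
      intro i hi
      rw [step, ih (i + 1) (by omega), hc i (by omega), if_neg (by omega), mul_zero, sub_zero]
  simpa using main N 0 (zero_add N)

end Curl

/-! ### Sideways crossings next to a bubble. -/

theorem mul_mul_eq {R : Type*} [Semigroup R] {a b c d : R} (h : a * b = c * d) (z : R) :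
    a * (b * z) = c * (d * z) := by
  rw [← mul_assoc, h, mul_assoc]

theorem mul_mul_eq' {R : Type*} [Semigroup R] {a b c : R} (h : a * b = c) (z : R) :
    a * (b * z) = c * z := by
  rw [← mul_assoc, h]

namespace Rep

variable {χ : Params k} {m : ℤ} {R : Type*} [Ring R] [Algebra k R] (ρ : Rep χ m R)

theorem crossEF_whisker (a b : Word) : ρ.φ (UChi.whisker k a b (crossEF k)) =
    ρ.s (a ++ [F, E]) .capEF b * (ρ.s (a ++ [F]) .crossE (F :: b) *
      ρ.s a .cupFE (E :: F :: b)) := by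
  simp [crossEF, whisker_sl, φ_sl, mul_assoc]

theorem crossFE_whisker (a b : Word) : ρ.φ (UChi.whisker k a b (crossFE k)) =
    ρ.s a .capFE (E :: F :: b) * (ρ.s (a ++ [F]) .crossE (F :: b) *
      ρ.s (a ++ [F, E]) .cupEF b) := by
  simp [crossFE, whisker_sl, φ_sl, mul_assoc]

/-- Pulling a cup through a sideways crossing. -/
theorem crossEF_mul_cupFE : ρ.φ (UChi.whisker k [] [E] (crossEF k)) * ρ.s [E] .cupFE [] =
    ρ.s [F] .crossE [] * ρ.s [] .cupFE [E] := by
  have h1 : ρ.s [] .cupFE [E, F, E] * ρ.s [E] .cupFE [] =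
      ρ.s [F, E, E] .cupFE [] * ρ.s [] .cupFE [E] := ρ.interchange [] .cupFE [E] .cupFE []
  have h2 : ρ.s [F] .crossE [F, E] * ρ.s [F, E, E] .cupFE [] =
      ρ.s [F, E, E] .cupFE [] * ρ.s [F] .crossE [] := ρ.interchange [F] .crossE [] .cupFE []
  have h3 : ρ.s [F, E] .capEF [E] * ρ.s [F, E, E] .cupFE [] = ρ.e [F, E, E] :=
    ρ.zigzag₃ [F, E] []
  have h4 : ρ.e [F, E, E] * ρ.s [F] .crossE [] = ρ.s [F] .crossE [] := ρ.e_mul_s rfl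
  rw [crossEF_whisker]
  simp only [List.nil_append, mul_assoc]
  rw [h1, mul_mul_eq h2, mul_mul_eq' h3, mul_mul_eq' h4]

/-- The outer cap straightens the cup hidden in the sideways crossing by a zigzag, leaving an
ordinary crossing under a cap on the left. -/
theorem capFE_mul_crossFE : ρ.s [E] .capFE [] * ρ.φ (UChi.whisker k [] [E] (crossFE k)) =
    ρ.s [] .capFE [E] * ρ.s [F] .crossE [] := by
  have h1 : ρ.s [] .capFE [E] * ρ.s [F, E, E] .capFE [] =
      ρ.s [E] .capFE [] * ρ.s [] .capFE [E, F, E] := ρ.interchange [] .capFE [E] .capFE []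
  have h2 : ρ.s [F] .crossE [] * ρ.s [F, E, E] .capFE [] =
      ρ.s [F, E, E] .capFE [] * ρ.s [F] .crossE [F, E] :=
    (ρ.interchange [F] .crossE [] .capFE [])
  have h3 : ρ.s [F, E, E] .capFE [] * ρ.s [F, E] .cupEF [E] = ρ.e [F, E, E] :=
    ρ.zigzag₁ [F, E] []
  have h4 : ρ.s [F] .crossE [] * ρ.e [F, E, E] = ρ.s [F] .crossE [] := ρ.s_mul_e rfl
  rw [crossFE_whisker]
  simp only [List.nil_append]
  rw [mul_mul_eq h1.symm, mul_mul_eq h2.symm, h3, h4]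

theorem crossEF_mul_dot (a : ℕ) :
    ρ.φ (UChi.whisker k [] [E] (crossEF k)) * ρ.s [E, F] .dotE [] ^ a =
      ρ.s [F, E] .dotE [] ^ a * ρ.φ (UChi.whisker k [] [E] (crossEF k)) := by
  have h1 : SemiconjBy (ρ.s [] .cupFE [E, F, E]) (ρ.s [E, F] .dotE [])
      (ρ.s [F, E, E, F] .dotE []) := ρ.interchange [] .cupFE [E, F] .dotE []
  have h2 : SemiconjBy (ρ.s [F] .crossE [F, E]) (ρ.s [F, E, E, F] .dotE [])
      (ρ.s [F, E, E, F] .dotE []) := ρ.interchange [F] .crossE [F] .dotE []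
  have h3 : SemiconjBy (ρ.s [F, E] .capEF [E]) (ρ.s [F, E, E, F] .dotE [])
      (ρ.s [F, E] .dotE []) := ρ.interchange [F, E] .capEF [] .dotE []
  rw [crossEF_whisker]
  exact ((h3.mul_left (h2.mul_left h1)).pow_right a)

/-- The right bubble on `E` rewritten through the decomposition of `EF`. -/
theorem capFE_cross_cross_cupFE (a : ℕ) :
    ρ.s [E] .capFE [] * (ρ.φ (UChi.whisker k [] [E] (crossFE k)) *
      ρ.φ (UChi.whisker k [] [E] (crossEF k))) * ρ.s [E, F] .dotE [] ^ a * ρ.s [E] .cupFE [] =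
    ρ.s [] .capFE [E] * ρ.s [F] .crossE [] * ρ.s [F, E] .dotE [] ^ a * ρ.s [F] .crossE [] *
      ρ.s [] .cupFE [E] := by
  rw [← mul_assoc, capFE_mul_crossFE]
  simp only [mul_assoc]
  rw [mul_mul_eq (ρ.crossEF_mul_dot a), crossEF_mul_cupFE]

/-- Mirror situation: the outer cup straightens the cap hidden in the sideways crossing, leaving an
ordinary crossing over a cup on the right. -/
theorem crossFE_mul_cupEF : ρ.φ (UChi.whisker k [E] [] (crossFE k)) * ρ.s [] .cupEF [E] =
    ρ.s [] .crossE [F] * ρ.s [E] .cupEF [] := by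
  have h1 : ρ.s [] .cupEF [E, E, F] * ρ.s [E] .cupEF [] =
      ρ.s [E, F, E] .cupEF [] * ρ.s [] .cupEF [E] := ρ.interchange [] .cupEF [E] .cupEF []
  have h2 : ρ.s [] .cupEF [E, E, F] * ρ.s [] .crossE [F] =
      ρ.s [E, F] .crossE [F] * ρ.s [] .cupEF [E, E, F] := ρ.interchange [] .cupEF [] .crossE [F]
  have h3 : ρ.s [E] .capFE [E, F] * ρ.s [] .cupEF [E, E, F] = ρ.e [E, E, F] :=
    ρ.zigzag₁ [] [E, F]
  have h4 : ρ.e [E, E, F] * ρ.s [] .crossE [F] = ρ.s [] .crossE [F] := ρ.e_mul_s rfl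
  rw [crossFE_whisker]
  simp only [List.cons_append, List.nil_append, mul_assoc]
  rw [← h1, mul_mul_eq h2.symm, mul_mul_eq' h3, mul_mul_eq' h4]

theorem capEF_mul_crossEF : ρ.s [] .capEF [E] * ρ.φ (UChi.whisker k [E] [] (crossEF k)) =
    ρ.s [E] .capEF [] * ρ.s [] .crossE [F] := by
  have h1 : ρ.s [] .capEF [E] * ρ.s [E, F, E] .capEF [] =
      ρ.s [E] .capEF [] * ρ.s [] .capEF [E, E, F] := ρ.interchange [] .capEF [E] .capEF []
  have h2 : ρ.s [] .capEF [E, E, F] * ρ.s [E, F] .crossE [F] =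
      ρ.s [] .crossE [F] * ρ.s [] .capEF [E, E, F] := ρ.interchange [] .capEF [] .crossE [F]
  have h3 : ρ.s [] .capEF [E, E, F] * ρ.s [E] .cupFE [E, F] = ρ.e [E, E, F] :=
    ρ.zigzag₃ [] [E, F]
  have h4 : ρ.s [] .crossE [F] * ρ.e [E, E, F] = ρ.s [] .crossE [F] := ρ.s_mul_e rfl
  rw [crossEF_whisker]
  simp only [List.cons_append, List.nil_append]
  rw [mul_mul_eq h1, mul_mul_eq h2, h3, h4]

theorem crossFE_mul_dot (a : ℕ) :
    ρ.φ (UChi.whisker k [E] [] (crossFE k)) * ρ.s [] .dotE [F, E] ^ a =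
      ρ.s [] .dotE [E, F] ^ a * ρ.φ (UChi.whisker k [E] [] (crossFE k)) := by
  have h1 : SemiconjBy (ρ.s [E, F, E] .cupEF []) (ρ.s [] .dotE [F, E])
      (ρ.s [] .dotE [F, E, E, F]) := (ρ.interchange [] .dotE [F, E] .cupEF []).symm
  have h2 : SemiconjBy (ρ.s [E, F] .crossE [F]) (ρ.s [] .dotE [F, E, E, F])
      (ρ.s [] .dotE [F, E, E, F]) := (ρ.interchange [] .dotE [F] .crossE [F]).symm
  have h3 : SemiconjBy (ρ.s [E] .capFE [E, F]) (ρ.s [] .dotE [F, E, E, F])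
      (ρ.s [] .dotE [E, F]) := (ρ.interchange [] .dotE [] .capFE [E, F]).symm
  rw [crossFE_whisker]
  exact ((h3.mul_left (h2.mul_left h1)).pow_right a)

/-- The left bubble on `E` rewritten through the decomposition of `FE`. -/
theorem capEF_cross_cross_cupEF (a : ℕ) :
    ρ.s [] .capEF [E] * (ρ.φ (UChi.whisker k [E] [] (crossEF k)) *
      ρ.φ (UChi.whisker k [E] [] (crossFE k))) * ρ.s [] .dotE [F, E] ^ a * ρ.s [] .cupEF [E] =
    ρ.s [E] .capEF [] * ρ.s [] .crossE [F] * ρ.s [] .dotE [E, F] ^ a * ρ.s [] .crossE [F] *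
      ρ.s [E] .cupEF [] := by
  rw [← mul_assoc, capEF_mul_crossEF]
  simp only [mul_assoc]
  rw [mul_mul_eq (ρ.crossFE_mul_dot a), crossFE_mul_cupEF]

end Rep

end

end UChi

/-! ### The four identities as scalars annihilating the identity of E. -/

namespace UChi

open Strand

section

universe u

variable {k : Type u} [Field k]

theorem Word.weight_E : Word.weight [E] = 2 := rfl

theorem Word.weight_F : Word.weight [F] = -2 := rfl

theorem Word.weight_nil : Word.weight [] = 0 := rfl

namespace Rep

variable {χ : Params k} {m : ℤ} {R : Type*} [Ring R] [Algebra k R] (ρ : Rep χ m R)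

/-- The bubble of degree zero to the right of E, in region n - 2, is computed directly and by
inserting β_n σ'σ between strand and bubble. -/
theorem cMinus_smul_e (n : ℤ) (hm : m = n - 2) (hn : n ≤ 0) :
    ((χ.cMinus (n - 2) : k) + χ.β n * χ.cMinus n) • ρ.e [E] = 0 := by
  obtain ⟨N, rfl⟩ : ∃ N : ℕ, n = -N := ⟨n.natAbs, by omega⟩
  have hbub : ρ.s [E] .capFE [] * ρ.s [E, F] .dotE [] ^ (N + 1) * ρ.s [E] .cupFE [] =
      (χ.cMinus (-N - 2) : k) • ρ.e [E] :=
    ρ.ccwZero [E] [] _ (N + 1) (by rw [Word.weight_nil]; omega) (by push_cast; ring)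
  have hid := ρ.identEF [] [E] (-N) (by rw [Word.weight_E]; omega) hn
  have he : ρ.s [E] .capFE [] * ρ.e [E, F, E] = ρ.s [E] .capFE [] := ρ.s_mul_e rfl
  have hcurl := cross_pow_cross (K := ρ.s [] .capFE [E]) (U := ρ.s [] .cupFE [E])
    (L := ρ.s [F] .dotE [E]) (D := ρ.s [F, E] .dotE []) (t := ρ.s [F] .crossE [])
    (x := ρ.s [] .dotE []) (e := ρ.e [F, E, E]) (E := ρ.e [E]) (c := (χ.cMinus (-N) : k)) (N := N)
    (ρ.dotSlide₂ [F] []) (ρ.crossSq [F] []) (ρ.interchange [F] .dotE [] .dotE [])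
    (ρ.interchange [] .capFE [] .dotE []) (ρ.interchange [] .cupFE [] .dotE []).symm
    (ρ.e_mul_s rfl) (ρ.e_mul_s rfl) (ρ.e_mul_s rfl)
    -- In region -N the counter-clockwise bubble of degree zero carries N - 1 dots; fewer dots give
    -- negative degree.
    (fun p hp => by
      split_ifs with h
      · exact ρ.ccwZero [] [E] _ p (by rw [Word.weight_E]; omega) (by omega)
      · exact ρ.ccwNeg [] [E] p (by rw [Word.weight_E]; omega))
    (by
      have := ρ.leftCurl [] [] (-N) (by rw [Word.weight_nil]; omega) hn
      split_ifs at this ⊢ with h h' h'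
      · rw [h]; exact this
      · omega
      · omega
      · exact this)
  -- Absorbing the idempotent of EFE into the cap creates the place where the decomposition of EF is
  -- substituted.
  rw [← he] at hbub
  simp only [List.nil_append] at hid
  rw [hid, mul_smul_comm, smul_mul_assoc, smul_mul_assoc, ρ.capFE_cross_cross_cupFE, hcurl] at hbub
  rw [add_smul, ← hbub, mul_smul]
  simp

/-- Mirror image of `cMinus_smul_e`: the clockwise bubble stands to the left of E, in region n + 2,
and FE 1_n is decomposed. -/
theorem cPlus_smul_e (n : ℤ) (hm : m = n) (hn : 0 ≤ n) :
    ((χ.cPlus (n + 2) : k) + χ.β n * χ.cPlus n) • ρ.e [E] = 0 := by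
  obtain ⟨N, rfl⟩ : ∃ N : ℕ, n = N := ⟨n.natAbs, by omega⟩
  have hbub : ρ.s [] .capEF [E] * ρ.s [] .dotE [F, E] ^ (N + 1) * ρ.s [] .cupEF [E] =
      (χ.cPlus (N + 2) : k) • ρ.e [E] :=
    ρ.cwZero [] [E] _ (N + 1) (by rw [Word.weight_E]; omega) (by push_cast; ring)
  have hid := ρ.identFE [E] [] N (by rw [Word.weight_nil]; omega) hn
  have he : ρ.s [] .capEF [E] * ρ.e [E, F, E] = ρ.s [] .capEF [E] := ρ.s_mul_e rfl
  -- Reflection exchanges the two dot slides and so reverses a sign. Taking `t` to be minus the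
  -- crossing restores the required form and also absorbs the sign of the right curl.
  have hcurl := cross_pow_cross (K := ρ.s [E] .capEF []) (U := ρ.s [E] .cupEF [])
    (L := ρ.s [E] .dotE [F]) (D := ρ.s [] .dotE [E, F]) (t := -ρ.s [] .crossE [F])
    (x := ρ.s [] .dotE []) (e := ρ.e [E, E, F]) (E := ρ.e [E]) (c := (χ.cPlus N : k)) (N := N)
    (by
      have : ρ.s [] .crossE [F] * ρ.s [] .dotE [E, F] =
        ρ.s [E] .dotE [F] * ρ.s [] .crossE [F] + ρ.e [E, E, F] := ρ.dotSlide₁ [] [F]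
      rw [mul_neg, neg_mul, this]; abel)
    (by rw [neg_mul_neg]; exact ρ.crossSq [] [F]) (ρ.interchange [] .dotE [] .dotE [F]).symm
    (ρ.interchange [] .dotE [] .capEF []).symm (ρ.interchange [] .dotE [] .cupEF [])
    (ρ.e_mul_s rfl) (by rw [mul_neg]; exact congrArg _ (ρ.e_mul_s rfl)) (ρ.e_mul_s rfl)
    (fun p hp => by
      split_ifs with h
      · exact ρ.cwZero [E] [] _ p (by rw [Word.weight_nil]; omega) (by omega)
      · exact ρ.cwNeg [E] [] p (by rw [Word.weight_nil]; omega))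
    (by
      have := ρ.rightCurl [] [] N (by rw [Word.weight_nil]; omega) hn
      rw [mul_neg, neg_mul, neg_eq_iff_eq_neg]
      split_ifs at this ⊢ with h h' h'
      · rw [h]; exact this
      · omega
      · omega
      · rw [neg_zero]; exact this)
  simp only [mul_neg, neg_mul, neg_neg] at hcurl
  rw [← he] at hbub
  simp only [List.cons_append, List.nil_append] at hid
  rw [hid, mul_smul_comm, smul_mul_assoc, smul_mul_assoc, ρ.capEF_cross_cross_cupEF, hcurl] at hbub
  rw [add_smul, ← hbub, mul_smul]
  simp

/-- The undotted bubble in region -1 is compared with the decomposition of EF 1_1. -/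
theorem cMinus_neg_one_smul_e (hm : m = -1) :
    ((χ.cMinus (-1) : k) - (χ.cPlus 1 : k)⁻¹) • ρ.e [E] = 0 := by
  have hbub : ρ.s [E] .capFE [] * ρ.s [E, F] .dotE [] ^ 0 * ρ.s [E] .cupFE [] =
      (χ.cMinus (-1) : k) • ρ.e [E] :=
    ρ.ccwZero [E] [] _ 0 (by rw [Word.weight_nil]; omega) (by norm_num)
  have hid := ρ.identEF_one [] [E] (by rw [Word.weight_E]; omega)
  have he : ρ.s [E] .capFE [] * ρ.e [E, F, E] = ρ.s [E] .capFE [] := ρ.s_mul_e rfl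
  have hcross := ρ.capFE_cross_cross_cupFE 0
  have htt : ρ.s [F] .crossE [] * ρ.s [F] .crossE [] = 0 := ρ.crossSq [F] []
  have h1 : ρ.s [E] .capFE [] * ρ.s [] .cupEF [E] = ρ.e [E] := ρ.zigzag₁ [] []
  have h3 : ρ.s [] .capEF [E] * ρ.s [E] .cupFE [] = ρ.e [E] := ρ.zigzag₃ [] []
  have h5 : ρ.e [E] * ρ.s [] .capEF [E] = ρ.s [] .capEF [E] := ρ.e_mul_s rfl
  -- With no dots between them the two crossings multiply to zero, so only the cup-cap correction
  -- survives.
  rw [pow_zero, mul_one, pow_zero, mul_one, mul_assoc (ρ.s [] .capFE [E]) _ (ρ.s [F] .crossE []), htt,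
    mul_zero, zero_mul] at hcross
  simp only [List.nil_append] at hid
  rw [pow_zero, mul_one, ← he, hid, mul_add, add_mul, mul_smul_comm, smul_mul_assoc, hcross,
    smul_zero, zero_add, mul_smul_comm, smul_mul_assoc, ← mul_assoc, h1, h5, h3] at hbub
  rw [sub_smul, hbub, sub_self]

/-- The extra strand E on the right serves to cancel the cup of EF by a zigzag at the end; closing
that cup with a cap in region 0 would instead give a bubble of degree 2, not a scalar. -/
theorem degree_zero_smul_e (hm : m = -2) :
    (1 + (χ.β 0 : k) * χ.cPlus 0 * χ.cMinus 0) • ρ.e [E] = 0 := by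
  have hid := ρ.identEF [] [E] 0 (by rw [Word.weight_E]; omega) le_rfl
  have h1 : ρ.s [] .cupFE [E, F, E] * ρ.s [] .cupEF [E] =
      ρ.s [F, E] .cupEF [E] * ρ.s [] .cupFE [E] := ρ.interchange [] .cupFE [] .cupEF [E]
  have h2 : ρ.s [F, E] .capEF [E] * ρ.s [F] .crossE [F, E] * ρ.s [F, E] .cupEF [E] =
      -((χ.cPlus 0 : k) • ρ.e [F, E, E]) := by
    simpa using ρ.rightCurl [F] [E] 0 (by rw [Word.weight_E]; omega) le_rfl
  have h3 : ρ.s [] .capFE [E, F, E] * ρ.s [F] .crossE [F, E] * ρ.s [] .cupFE [E, F, E] =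
      (χ.cMinus 0 : k) • ρ.e [E, F, E] := by
    simpa using ρ.leftCurl [] [F, E] 0 (by simp [Word.weight, Strand.weight, hm]) le_rfl
  have h4 : ρ.e [F, E, E] * ρ.s [] .cupFE [E] = ρ.s [] .cupFE [E] := ρ.e_mul_s rfl
  have h5 : ρ.e [E, F, E] * ρ.s [] .cupEF [E] = ρ.s [] .cupEF [E] := ρ.e_mul_s rfl
  have h6 : ρ.s [E] .capFE [] * ρ.s [] .cupEF [E] = ρ.e [E] := ρ.zigzag₁ [] []
  -- Exchanging the heights of the two cups exposes the right curl in region 0, inside σ.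
  have hσ : ρ.φ (UChi.whisker k [] [E] (crossEF k)) * ρ.s [] .cupEF [E] =
      -((χ.cPlus 0 : k) • ρ.s [] .cupFE [E]) := by
    rw [crossEF_whisker]
    simp only [List.nil_append, mul_assoc]
    rw [h1, ← mul_assoc, ← mul_assoc, mul_assoc (ρ.s [F, E] .capEF [E]), ← mul_assoc, h2, neg_mul,
      smul_mul_assoc, h4]
  have hσ' : ρ.φ (UChi.whisker k [] [E] (crossFE k)) * ρ.s [] .cupFE [E] =
      (χ.cMinus 0 : k) • ρ.s [] .cupEF [E] := by
    rw [crossFE_whisker]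
    simp only [List.nil_append, mul_assoc]
    rw [← h1, ← mul_assoc, ← mul_assoc, mul_assoc (ρ.s [] .capFE [E, F, E]), ← mul_assoc, h3,
      smul_mul_assoc, h5]
  have h7 : ρ.s [] .cupEF [E] =
      -(((χ.β 0 : k) * χ.cPlus 0 * χ.cMinus 0) • ρ.s [] .cupEF [E]) := by
    simp only [List.nil_append] at hid
    conv_lhs => rw [← h5, hid, smul_mul_assoc, mul_assoc, hσ, mul_neg, mul_smul_comm, hσ',
      smul_neg, smul_smul, smul_smul]
  have h8 := congrArg (ρ.s [E] .capFE [] * ·) h7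
  simp only [mul_neg, mul_smul_comm, h6] at h8
  rw [add_smul, one_smul]
  nth_rewrite 1 [h8]
  exact neg_add_cancel _

end Rep

/-- If the calculus is consistent, then nonzero multiples of the identity of `E 1_n` are
nonzero: one may close the strand to a bubble of degree zero. -/
theorem Consistent.eq_zero_of_smul_e_E {χ : Params k} (hχ : Consistent χ) (n : ℤ) {c : k}
    (h : ∀ (R : Type u) [Ring R] [Algebra k R] (ρ : Rep χ n R), c • ρ.e [E] = 0) : c = 0 := by
  -- One side of the strand always admits a real bubble of degree zero: for n ≤ -1 close to the left
  -- around region n; for n ≥ 0 close to the right inside region n + 2 ≥ 2.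
  rcases le_or_gt n (-1) with hn | hn
  · obtain ⟨p, hp⟩ : ∃ p : ℕ, -n - 1 = p := ⟨(-n - 1).toNat, by omega⟩
    set ρ := unitRep χ n
    have h1 : c • ρ.e [F, E] = 0 := h _ (ρ.whisker [F] [] (by rw [Word.weight_nil, add_zero]))
    have h2 : ρ.s [] .capFE [] * ρ.s [F] .dotE [] ^ p * ρ.s [] .cupFE [] =
        (χ.cMinus n : k) • ρ.e [] :=
      ρ.ccwZero [] [] n p (by rw [Word.weight_nil, add_zero]) hp
    have h3 : ρ.e [F, E] * ρ.s [] .cupFE [] = ρ.s [] .cupFE [] := ρ.e_mul_s rfl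
    have h4 : (c * χ.cMinus n) • ρ.e [] = 0 := by
      rw [mul_smul, ← h2, ← h3, ← mul_smul_comm, ← smul_mul_assoc, h1, zero_mul, mul_zero]
    exact (mul_eq_zero.1 (hχ.eq_zero_of_smul_e_nil n h4)).resolve_right (χ.cMinus n).ne_zero
  · obtain ⟨p, hp⟩ : ∃ p : ℕ, n + 2 - 1 = p := ⟨(n + 1).toNat, by omega⟩
    set ρ := unitRep χ (n + 2)
    have h1 : c • ρ.e [E, F] = 0 := h _ (ρ.whisker [] [F] (by rw [Word.weight_F]; ring))
    have h2 : ρ.s [] .capEF [] * ρ.s [] .dotE [F] ^ p * ρ.s [] .cupEF [] =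
        (χ.cPlus (n + 2) : k) • ρ.e [] :=
      ρ.cwZero [] [] (n + 2) p (by rw [Word.weight_nil, add_zero]) hp
    have h3 : ρ.e [E, F] * ρ.s [] .cupEF [] = ρ.s [] .cupEF [] := ρ.e_mul_s rfl
    have h4 : (c * χ.cPlus (n + 2)) • ρ.e [] = 0 := by
      rw [mul_smul, ← h2, ← h3, ← mul_smul_comm, ← smul_mul_assoc, h1, zero_mul, mul_zero]
    exact (mul_eq_zero.1 (hχ.eq_zero_of_smul_e_nil _ h4)).resolve_right
      (χ.cPlus (n + 2)).ne_zero

end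

end UChi

theorem mainTheorem4 {k : Type*} [Field k] (χ : UChi.Params k) (hχ : UChi.Consistent χ) :
    -(χ.cPlus 0 : k) * (χ.cMinus 0 : k) * (χ.β 0 : k) = 1 ∧
    (χ.cMinus (-1) : k) = 1 / (χ.cPlus 1 : k) ∧
    (∀ n : ℤ, n ≤ 0 → (χ.cMinus (n - 2) : k) = -(χ.β n : k) * (χ.cMinus n : k)) ∧
    (∀ n : ℤ, 0 ≤ n → (χ.cPlus (n + 2) : k) = -(χ.β n : k) * (χ.cPlus n : k)) := by
  refine ⟨?_, ?_, fun n hn => ?_, fun n hn => ?_⟩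
  · linear_combination -hχ.eq_zero_of_smul_e_E (-2) fun _ _ _ ρ => ρ.degree_zero_smul_e rfl
  · rw [one_div]
    exact sub_eq_zero.1 (hχ.eq_zero_of_smul_e_E (-1) fun _ _ _ ρ => ρ.cMinus_neg_one_smul_e rfl)
  · linear_combination hχ.eq_zero_of_smul_e_E (n - 2) fun _ _ _ ρ => ρ.cMinus_smul_e n rfl hn
  · linear_combination hχ.eq_zero_of_smul_e_E n fun _ _ _ ρ => ρ.cPlus_smul_e n rfl hn
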